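/- Let $p,q\ge 0$ be fixed integers and consider observations $x_i=Ms_i+\sqrt{\sigma}\,n_i\in\mathbb{R}^p$, $i=1,2,\dots$, where $M\in\mathbb{R}^{p\times q}$ has linearly independent columns, $\sigma>0$ is the noise variance, the noise vectors $n_i$ have the standard Gaussian distribution $\mathcal N(0,I_p)$, the signal vectors $s_i\in\mathbb{R}^q$ are identically distributed and square integrable with mean zero and positive definite covariance matrix, the pairs $(s_i,n_i)$, $i\ge 1$, are independent, and $s_i$ is independent of $n_i$ for each $i$. (In particular, the $s_i$ may be Gaussian.) Thus the true covariance matrix is $\Sigma=BB^T+\sigma I_p$ with $B\in\mathbb{R}^{p\times q}$ of rank $q$, and $q$ is the dimension of the principal subspace $\mathrm{span}(B)$. Let $\ell_1\ge\dots\ge\ell_p$ be the eigenvalues of the sample covariance matrix $S_n=\frac1n\sum_{i=1}^n x_ix_i^T$, let $(C_n)$ be a real sequence, and put $$IC(k)=\frac{n}{2\sigma^2}\sum_{i=k+1}^p(\ell_i-\sigma)^2-C_n\frac{(p-k)(p-k-1)}{2}.$$ Let $K\subseteq\{0,1,\dots,p\}$ be the set of candidate dimensions, with $q\in K$; if $q=p-1$,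 assume that $p\notin K$. For each $n$ let $\hat k=\hat k_n$ be any minimiser of $IC(k)$ over $k\in K$. If $$\lim_{n\to\infty}\frac{C_n}{n}=0\quad\text{and}\quad\lim_{n\to\infty}\frac{C_n}{\log\log n}=\infty,$$ then $\lim_{n\to\infty}\hat k_n=q$ almost surely. -/

import Mathlib

open MeasureTheory ProbabilityTheory Filter Topology

/-- The observation `x = M s + √σ z`: signal `s`, mixing matrix `M`, white noise `z`,
noise variance `σ`. -/
noncomputable def observation {p q : ℕ} (M : Matrix (Fin p) (Fin q) ℝ) (σ : ℝ)
    (s : Fin q → ℝ) (z : Fin p → ℝ) : Fin p → ℝ :=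
  M.mulVec s + Real.sqrt σ • z

/-- The sample covariance matrix `S_n = (1/n) ∑ x_i x_iᵀ` of the first `n` observations
`x 0, …, x (n - 1)`. -/
noncomputable def sampleCov {p : ℕ} (x : ℕ → Fin p → ℝ) (n : ℕ) :
    Matrix (Fin p) (Fin p) ℝ :=
  (1 / (n : ℝ)) • ∑ i ∈ Finset.range n, Matrix.vecMulVec (x i) (x i)

theorem sampleCov_isHermitian {p : ℕ} (x : ℕ → Fin p → ℝ) (n : ℕ) :
    (sampleCov x n).IsHermitian := by
  ext a b
  simp [sampleCov, Matrix.sum_apply, Matrix.vecMulVec_apply, mul_comm]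

/-- The eigenvalues of the sample covariance matrix, with multiplicity, in decreasing order
(`Matrix.IsHermitian.eigenvalues₀` is antitone). The index `i : Fin p` starts at `0`, so
`sampleEig x n i` is the `(i + 1)`-st largest eigenvalue. -/
noncomputable def sampleEig {p : ℕ} (x : ℕ → Fin p → ℝ) (n : ℕ) (i : Fin p) : ℝ :=
  (sampleCov_isHermitian x n).eigenvalues₀ (Fin.cast (Fintype.card_fin p).symm i)

/-- The criterion
`IC(k) = n / (2 σ²) * ∑_{i = k+1}^p (ℓ_i - σ)² - C * (p - k) (p - k - 1) / 2`,
where `ℓ_1 ≥ … ≥ ℓ_p` are the eigenvalues of the sample covariance matrix; in the `0`-based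
indexing of `sampleEig` the sum runs over the indices `i` with `k ≤ i`. -/
noncomputable def IC {p : ℕ} (σ C : ℝ) (x : ℕ → Fin p → ℝ) (n k : ℕ) : ℝ :=
  (n : ℝ) / (2 * σ ^ 2) *
      ∑ i : Fin p with k ≤ i.val, (sampleEig x n i - σ) ^ 2
    - C * (((p : ℝ) - (k : ℝ)) * ((p : ℝ) - (k : ℝ) - 1) / 2)

/-- The matrix of second moments `E[s sᵀ]`, which is the covariance matrix of `s` when `s` has
mean zero. -/
noncomputable def secondMoment {Ω : Type*} [MeasurableSpace Ω] (P : Measure Ω) {q : ℕ}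
    (s : Ω → Fin q → ℝ) : Matrix (Fin q) (Fin q) ℝ :=
  Matrix.of fun a b => ∫ ω, s ω a * s ω b ∂P

/-! With r_n = √(n log log n), almost surely yᵀS_n y equals a signal form plus (σ + O(r_n/n))|y|².
The signal form is nonnegative, vanishes on ker Mᵀ, and by the strong law is eventually at least
κ|y|² on range M. Courant–Fischer then puts the top q eigenvalues above σ + κ/2 and the others
within O(r_n/n) of σ (`sampleEig_asymptotics`). No rate is needed for the signal covariance, so two
moments of s suffice.

For k < q the fit term of IC(k) exceeds that of IC(q) by at least a constant times n, while the
penalties differ by O(C_n) = o(n). For k > q the fit improves by only n · O(r_n²/n²) = O(log log n),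
which the penalty outweighs, its coefficient being positive unless q = p - 1 and k = p. As K is
finite, q is eventually the only minimiser.

The rate r_n comes from `ae_exists_eventually_sum_le`: if E exp(tY - t²V) ≤ 1 for small t and the
sums of V are O(n), a maximal inequality on dyadic blocks and Borel–Cantelli bound the sums of Y.
Cross terms s·z use V = s², centred noise squares use V = 4. -/

/-! ### Maximal inequalities for products and exponentials of sums -/

/-- Partial products of independent nonnegative mean-one variables form a martingale of mean one, so
Doob's maximal inequality applies. -/
theorem measure_exists_le_prod_le {Ω : Type*} [MeasurableSpace Ω] {P : Measure Ω}
    [IsProbabilityMeasure P] {W : ℕ → Ω → ℝ} (hm : ∀ i, Measurable (W i)) (h0 : ∀ i ω, 0 ≤ W i ω)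
    (hind : iIndepFun W P) (hint : ∀ i, Integrable (W i) P) (h1 : ∀ i, ∫ ω, W i ω ∂P = 1)
    (N : ℕ) {a : ℝ} (ha : 0 < a) :
    P {ω | ∃ n ≤ N, a ≤ ∏ i ∈ Finset.range (n + 1), W i ω} ≤ ENNReal.ofReal a⁻¹ := by
  have hsm : ∀ i, StronglyMeasurable (W i) := fun i => (hm i).stronglyMeasurable
  set F := Filtration.natural W hsm
  set f : ℕ → Ω → ℝ := fun n ω => ∏ i ∈ Finset.range (n + 1), W i ω with hf
  have hsucc : ∀ n, f (n + 1) = f n * W (n + 1) := fun n => by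
    ext ω; simp [hf, Finset.prod_range_succ]
  have hadp : StronglyAdapted F f := by
    intro n
    apply Finset.stronglyMeasurable_fun_prod
    intro i hi
    exact (Filtration.stronglyAdapted_natural hsm i).mono
      (F.mono (by simpa [Nat.lt_succ_iff] using hi))
  have hfi : ∀ n, Integrable (f n) P ∧ ∫ ω, f n ω ∂P = 1 := by
    intro n
    induction n with
    | zero => simpa [hf] using ⟨hint 0, h1 0⟩
    | succ n ih =>
      have hI : IndepFun (f n) (W (n + 1)) P := by
        have := hind.indepFun_prod_range_succ hm (n + 1)
        convert this using 1
        ext ω; simp [hf]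
      rw [hsucc]
      refine ⟨hI.integrable_mul ih.1 (hint _), ?_⟩
      rw [hI.integral_mul_eq_mul_integral ih.1.1 (hint _).1, ih.2, h1, one_mul]
  have hsub : Submartingale f F P := by
    refine submartingale_nat hadp (fun n => (hfi n).1) fun n => ?_
    have h2 := condExp_mul_of_stronglyMeasurable_left (m := F n) (μ := P) (hadp n)
      (by rw [← hsucc]; exact (hfi _).1) (hint (n + 1))
    have h3 := hind.condExp_natural_ae_eq_of_lt hsm (Nat.lt_succ_self n)
    rw [hsucc]
    filter_upwards [h2, h3] with ω h2 h3
    rw [h2, Pi.mul_apply]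
    have : (P[W (n + 1)|F n]) ω = 1 := by rw [← h1 (n + 1)]; exact h3
    rw [this, mul_one]
  have hmax := maximal_ineq hsub (fun n ω => Finset.prod_nonneg fun i _ => h0 i ω)
    (ε := a.toNNReal) N
  have hset : {ω | ∃ n ≤ N, a ≤ ∏ i ∈ Finset.range (n + 1), W i ω} =
      {ω | ((a.toNNReal : NNReal) : ℝ) ≤ (Finset.range (N + 1)).sup'
        Finset.nonempty_range_add_one fun k => f k ω} := by
    ext ω
    simp [Real.coe_toNNReal _ ha.le, Finset.le_sup'_iff, hf]
  rw [hset]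
  set s := {ω | ((a.toNNReal : NNReal) : ℝ) ≤ (Finset.range (N + 1)).sup'
        Finset.nonempty_range_add_one fun k => f k ω}
  have hle : ENNReal.ofReal (∫ ω in s, f N ω ∂P) ≤ 1 := by
    rw [← ENNReal.ofReal_one]
    apply ENNReal.ofReal_le_ofReal
    rw [← (hfi N).2]
    exact setIntegral_le_integral (hfi N).1
      (ae_of_all _ fun ω => Finset.prod_nonneg fun i _ => h0 i ω)
  rw [ENNReal.ofReal_inv_of_pos ha, ← one_div, ENNReal.le_div_iff_mul_le (by simp [ha]) (by simp),
    mul_comm]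
  exact hmax.trans hle

/-- Dividing each exp X_i by its mean, which is at most 1, only enlarges the products and reduces to
the mean-one case. -/
theorem measure_exists_le_sum_le {Ω : Type*} [MeasurableSpace Ω] {P : Measure Ω}
    [IsProbabilityMeasure P] {X : ℕ → Ω → ℝ} (hm : ∀ i, AEMeasurable (X i) P)
    (hind : iIndepFun X P) (hexp : ∀ i, ∫⁻ ω, ENNReal.ofReal (Real.exp (X i ω)) ∂P ≤ 1)
    (N : ℕ) (a : ℝ) :
    P {ω | ∃ n ≤ N, a ≤ ∑ i ∈ Finset.range (n + 1), X i ω} ≤ ENNReal.ofReal (Real.exp (-a)) := by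
  set Z : ℕ → Ω → ℝ := fun i => (hm i).mk with hZ
  have hae : ∀ i, X i =ᵐ[P] Z i := fun i => (hm i).ae_eq_mk
  have hZm : ∀ i, Measurable (Z i) := fun i => (hm i).measurable_mk
  have hexpZ : ∀ i, ∫⁻ ω, ENNReal.ofReal (Real.exp (Z i ω)) ∂P ≤ 1 := fun i => by
    refine le_trans (le_of_eq (lintegral_congr_ae ?_)) (hexp i)
    filter_upwards [hae i] with ω h
    rw [h]
  have hint : ∀ i, Integrable (fun ω => Real.exp (Z i ω)) P := fun i => by
    refine ⟨(hZm i).exp.aestronglyMeasurable, ?_⟩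
    rw [hasFiniteIntegral_iff_ofReal (ae_of_all _ fun ω => (Real.exp_pos _).le)]
    exact (hexpZ i).trans_lt ENNReal.one_lt_top
  set c : ℕ → ℝ := fun i => ∫ ω, Real.exp (Z i ω) ∂P with hc
  have hc0 : ∀ i, 0 < c i := fun i => integral_exp_pos (hint i)
  have hc1 : ∀ i, c i ≤ 1 := fun i => by
    have := hexpZ i
    rw [← ofReal_integral_eq_lintegral_ofReal (hint i) (ae_of_all _ fun ω => (Real.exp_pos _).le),
      ENNReal.ofReal_le_one] at this
    exact this
  have key := measure_exists_le_prod_le (P := P) (W := fun i ω => Real.exp (Z i ω) / c i)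
    (fun i => (hZm i).exp.div_const _) (fun i ω => div_nonneg (Real.exp_pos _).le (hc0 i).le)
    ((hind.congr hae).comp (fun i x => Real.exp x / c i)
      (fun i => Real.measurable_exp.div_const _))
    (fun i => (hint i).div_const _)
    (fun i => by rw [integral_div]; exact div_self (hc0 i).ne') N (Real.exp_pos a)
  rw [← Real.exp_neg] at key
  refine le_trans (measure_mono_ae ?_) key
  filter_upwards [ae_all_iff.2 hae] with ω hω
  rintro ⟨n, hn, h⟩
  refine ⟨n, hn, ?_⟩
  calc Real.exp a ≤ Real.exp (∑ i ∈ Finset.range (n + 1), Z i ω) := by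
        rw [Real.exp_le_exp]
        simpa only [hω] using h
    _ = ∏ i ∈ Finset.range (n + 1), Real.exp (Z i ω) := Real.exp_sum _ _
    _ ≤ _ := Finset.prod_le_prod (fun i _ => (Real.exp_pos _).le) fun i _ =>
        le_div_self (Real.exp_pos _).le (hc0 i) (hc1 i)

/-! ### Bounds of iterated-logarithm order -/

theorem log_natLog_two_le {n : ℕ} (hn : 2 ≤ Real.log n) (h1 : 1 ≤ Nat.log 2 n) :
    Real.log (Nat.log 2 n) ≤ 2 * Real.log (Real.log n) := by
  have hn0 : n ≠ 0 := by rintro rfl; simp at h1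
  have h2 : (Nat.log 2 n : ℝ) * Real.log 2 ≤ Real.log n := by
    rw [← Real.log_pow]
    exact Real.log_le_log (by positivity) (by exact_mod_cast Nat.pow_log_le_self 2 hn0)
  have h3 := Real.log_two_gt_d9
  have h4 : (Nat.log 2 n : ℝ) ≤ Real.log n ^ 2 := by
    have : (0 : ℝ) ≤ Nat.log 2 n := by positivity
    nlinarith
  have h5 := Real.log_le_log (by exact_mod_cast h1) h4
  rwa [Real.log_pow] at h5

theorem tendsto_log_div_two_pow :
    Tendsto (fun k : ℕ => Real.log k / 2 ^ k) atTop (𝓝 0) := by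
  refine squeeze_zero (fun k => ?_) (fun k => ?_)
    (tendsto_pow_const_div_const_pow_of_one_lt 1 (one_lt_two (α := ℝ)))
  · exact div_nonneg (Real.log_natCast_nonneg k) (by positivity)
  · gcongr
    rw [pow_one]
    exact Real.log_le_self (by positivity)

theorem tendsto_log_natCast : Tendsto (fun n : ℕ => Real.log n) atTop atTop :=
  Real.tendsto_log_atTop.comp tendsto_natCast_atTop_atTop

/-- An upper bound of the order of the law of the iterated logarithm, for partial sums whose
summands satisfy a self-normalised exponential moment bound. -/
theorem ae_exists_eventually_sum_le {Ω : Type*} [MeasurableSpace Ω] {P : Measure Ω}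
    [IsProbabilityMeasure P] {Y V : ℕ → Ω → ℝ}
    (hY : ∀ i, AEMeasurable (Y i) P) (hV : ∀ i, AEMeasurable (V i) P)
    (hind : iIndepFun (fun i ω => (Y i ω, V i ω)) P) {t₀ : ℝ} (ht₀ : 0 < t₀)
    (hexp : ∀ i t, 0 ≤ t → t ≤ t₀ →
      ∫⁻ ω, ENNReal.ofReal (Real.exp (t * Y i ω - t ^ 2 * V i ω)) ∂P ≤ 1)
    (hsum : ∀ᵐ ω ∂P, ∃ B : ℝ, ∀ᶠ n : ℕ in atTop, ∑ i ∈ Finset.range n, V i ω ≤ B * n) :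
    ∀ᵐ ω ∂P, ∃ c : ℝ, ∀ᶠ n : ℕ in atTop,
      ∑ i ∈ Finset.range n, Y i ω ≤ c * Real.sqrt (n * Real.log (Real.log n)) := by
  -- This choice makes t_k² · 2^k = log k, so on the k-th dyadic block the compensator t²∑V has the
  -- same order as the level 2 log k.
  set t : ℕ → ℝ := fun k => Real.sqrt (Real.log k / 2 ^ k) with ht
  have htlim : Tendsto t atTop (𝓝 0) := by
    simpa only [Real.sqrt_zero] using tendsto_log_div_two_pow.sqrt
  obtain ⟨k₀, hk₀⟩ := eventually_atTop.1 (htlim.eventually_le_const ht₀)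
  -- The level 2 log k gives probability at most k⁻², which is summable.
  set A : ℕ → Set Ω := fun k => {ω | ∃ n ≤ 2 ^ (k + 1), 2 * Real.log k ≤
    ∑ i ∈ Finset.range (n + 1), (t k * Y i ω - t k ^ 2 * V i ω)} with hA
  have hPA : ∀ k, k₀ ≤ k → 1 ≤ k → P (A k) ≤ ENNReal.ofReal (1 / (k : ℝ) ^ 2) := by
    intro k hk hk1
    have := measure_exists_le_sum_le (P := P)
      (X := fun i ω => t k * Y i ω - t k ^ 2 * V i ω)
      (fun i => ((hY i).const_mul _).sub ((hV i).const_mul _))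
      (hind.comp (fun _ x => t k * x.1 - t k ^ 2 * x.2) (fun _ => by fun_prop))
      (fun i => hexp i (t k) (Real.sqrt_nonneg _) (hk₀ k hk)) (2 ^ (k + 1)) (2 * Real.log k)
    refine this.trans (le_of_eq ?_)
    congr 1
    have hk' : (0 : ℝ) < k := by exact_mod_cast hk1
    rw [Real.exp_neg, mul_comm, Real.exp_mul, Real.exp_log hk', one_div]
    norm_num
  set s : ℕ → Set Ω := fun k => {ω | (k₀ ≤ k ∧ 1 ≤ k) ∧ ω ∈ A k} with hs
  have hPs : ∀ k, P (s k) ≤ ENNReal.ofReal (1 / (k : ℝ) ^ 2) := by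
    intro k
    by_cases h : k₀ ≤ k ∧ 1 ≤ k
    · exact (measure_mono fun ω hω => hω.2).trans (hPA k h.1 h.2)
    · have : s k = ∅ := by ext ω; simp [hs, h]
      simp [this]
  have hfin : ∑' k, P (s k) ≠ ⊤ := by
    refine ne_top_of_le_ne_top ?_ (ENNReal.tsum_le_tsum hPs)
    exact (Real.summable_one_div_nat_pow.2 one_lt_two).tsum_ofReal_ne_top
  filter_upwards [ae_eventually_notMem hfin, hsum] with ω hBC ⟨B, hB⟩
  -- 2 is the level, 2|B| bounds the compensator since n ≤ 2^(k+1), and the last factor absorbs log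
  -- k ≤ 2 log log n.
  refine ⟨(2 + 2 * |B|) * 2, ?_⟩
  have hlog2 : Tendsto (fun n : ℕ => Nat.log 2 n) atTop atTop :=
    tendsto_atTop.2 fun b => (eventually_ge_atTop (2 ^ b)).mono fun n hn =>
      Nat.le_log_of_pow_le one_lt_two hn
  filter_upwards [hlog2.eventually hBC, hlog2.eventually_ge_atTop k₀, hlog2.eventually_ge_atTop 2,
    hB, tendsto_log_natCast.eventually_ge_atTop 2, eventually_ge_atTop 1]
    with n hn hkk hk2 hnB hlog hn1
  set k := Nat.log 2 n
  have hk1 : 1 ≤ k := by omega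
  have hkn : (2 : ℝ) ^ k ≤ n := by exact_mod_cast Nat.pow_log_le_self 2 (by omega)
  have hnk' : n < 2 ^ (k + 1) := Nat.lt_pow_succ_log_self one_lt_two n
  have hnk : (n : ℝ) ≤ 2 ^ k * 2 := by
    rw [← pow_succ]; exact_mod_cast hnk'.le
  set L := Real.log k with hL
  have hLpos : 0 < L := Real.log_pos (by exact_mod_cast hk2)
  have hsmall : ∑ i ∈ Finset.range n, (t k * Y i ω - t k ^ 2 * V i ω) < 2 * L := by
    by_contra! hcon
    refine hn ⟨⟨hkk, hk1⟩, n - 1, by omega, ?_⟩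
    rwa [Nat.sub_add_cancel hn1]
  rw [Finset.sum_sub_distrib, ← Finset.mul_sum, ← Finset.mul_sum] at hsmall
  have hpow : (0 : ℝ) < 2 ^ k := by positivity
  have htsq : t k ^ 2 = L / 2 ^ k := Real.sq_sqrt (by positivity)
  have htpos : 0 < t k := Real.sqrt_pos.2 (by positivity)
  have hVbd : t k ^ 2 * ∑ i ∈ Finset.range n, V i ω ≤ 2 * |B| * L := by
    calc t k ^ 2 * ∑ i ∈ Finset.range n, V i ω ≤ t k ^ 2 * (|B| * (2 ^ k * 2)) := by
          gcongr
          exact hnB.trans (mul_le_mul (le_abs_self B) hnk (by positivity) (abs_nonneg B))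
      _ = 2 * |B| * L := by rw [htsq]; field_simp
  have hmain : t k * ∑ i ∈ Finset.range n, Y i ω ≤ (2 + 2 * |B|) * L := by linarith
  have hLk : L ≤ 2 * Real.log (Real.log n) := log_natLog_two_le hlog hk1
  have hLsq : L = t k * Real.sqrt (L * 2 ^ k) := by
    rw [ht, ← Real.sqrt_mul (by positivity),
      show L / 2 ^ k * (L * 2 ^ k) = L ^ 2 by field_simp, Real.sqrt_sq hLpos.le]
  have hfinal : ∑ i ∈ Finset.range n, Y i ω ≤ (2 + 2 * |B|) * Real.sqrt (L * 2 ^ k) := by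
    rw [hLsq] at hmain
    refine le_of_mul_le_mul_left (hmain.trans (le_of_eq ?_)) htpos
    ring
  refine hfinal.trans ?_
  rw [mul_assoc]
  gcongr
  rw [Real.sqrt_le_left (by positivity), mul_pow, Real.sq_sqrt (by nlinarith)]
  nlinarith

theorem ae_exists_eventually_abs_sum_le {Ω : Type*} [MeasurableSpace Ω] {P : Measure Ω}
    [IsProbabilityMeasure P] {Y V : ℕ → Ω → ℝ}
    (hY : ∀ i, AEMeasurable (Y i) P) (hV : ∀ i, AEMeasurable (V i) P)
    (hind : iIndepFun (fun i ω => (Y i ω, V i ω)) P) {t₀ : ℝ} (ht₀ : 0 < t₀)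
    (hexp : ∀ i t, |t| ≤ t₀ →
      ∫⁻ ω, ENNReal.ofReal (Real.exp (t * Y i ω - t ^ 2 * V i ω)) ∂P ≤ 1)
    (hsum : ∀ᵐ ω ∂P, ∃ B : ℝ, ∀ᶠ n : ℕ in atTop, ∑ i ∈ Finset.range n, V i ω ≤ B * n) :
    ∀ᵐ ω ∂P, ∃ c : ℝ, ∀ᶠ n : ℕ in atTop,
      |∑ i ∈ Finset.range n, Y i ω| ≤ c * Real.sqrt (n * Real.log (Real.log n)) := by
  have h1 := ae_exists_eventually_sum_le hY hV hind ht₀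
    (fun i t h0 h => hexp i t (by rwa [abs_of_nonneg h0])) hsum
  have h2 := ae_exists_eventually_sum_le (Y := fun i ω => -Y i ω) (fun i => (hY i).neg) hV
    (hind.comp (fun _ x => (-x.1, x.2)) (fun _ => by fun_prop)) ht₀
    (fun i t h0 h => by
      simpa using hexp i (-t) (by rwa [abs_neg, abs_of_nonneg h0])) hsum
  filter_upwards [h1, h2] with ω ⟨c, hc⟩ ⟨d, hd⟩
  refine ⟨max c d, ?_⟩
  filter_upwards [hc, hd] with n hc hd
  rw [Finset.sum_neg_distrib] at hd
  have h0 := Real.sqrt_nonneg (n * Real.log (Real.log n))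
  rw [abs_le']
  exact ⟨hc.trans (mul_le_mul_of_nonneg_right (le_max_left _ _) h0),
    hd.trans (mul_le_mul_of_nonneg_right (le_max_right _ _) h0)⟩

/-! ### Exponential moments of the Gaussian terms -/

theorem lintegral_exp_mul_sub_gaussian (t : ℝ) :
    ∫⁻ x, ENNReal.ofReal (Real.exp (t * x - t ^ 2 / 2)) ∂(gaussianReal 0 1) = 1 := by
  have hint : Integrable (fun x => Real.exp (t * x - t ^ 2 / 2)) (gaussianReal 0 1) := by
    simp_rw [Real.exp_sub]
    exact (integrable_exp_mul_gaussianReal t).div_const _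
  rw [← ofReal_integral_eq_lintegral_ofReal hint (ae_of_all _ fun _ => (Real.exp_pos _).le)]
  have := congrFun (mgf_id_gaussianReal (μ := 0) (v := 1)) t
  simp only [mgf, id] at this
  simp_rw [Real.exp_sub]
  rw [integral_div, this]
  simp

/-- The integral is exp(-t - 4t²)(1 - 2t)^(-1/2). It is at most 1 because e^u ≥ 1 + u and (1 - 2t)(1
+ 2t + 8t²) = 1 + 4t²(1 - 4t) ≥ 1 for t ≤ 1/4. -/
theorem lintegral_exp_mul_sq_sub_gaussian_le {t : ℝ} (ht : |t| ≤ 1 / 4) :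
    ∫⁻ x, ENNReal.ofReal (Real.exp (t * (x ^ 2 - 1) - t ^ 2 * 4)) ∂(gaussianReal 0 1) ≤ 1 := by
  obtain ⟨ht1, ht2⟩ := abs_le.1 ht
  have hb : 0 < 1 / 2 - t := by linarith
  rw [gaussianReal_of_var_ne_zero 0 one_ne_zero,
    lintegral_withDensity_eq_lintegral_mul _ (measurable_gaussianPDF 0 1) (by fun_prop)]
  have heq : ∀ x : ℝ, (gaussianPDF 0 1 * fun x =>
      ENNReal.ofReal (Real.exp (t * (x ^ 2 - 1) - t ^ 2 * 4))) x =
      ENNReal.ofReal ((Real.sqrt (2 * Real.pi))⁻¹ * Real.exp (-t - 4 * t ^ 2) *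
        Real.exp (-(1 / 2 - t) * x ^ 2)) := by
    intro x
    rw [Pi.mul_apply, gaussianPDF, ← ENNReal.ofReal_mul (gaussianPDFReal_nonneg _ _ _),
      gaussianPDFReal]
    congr 1
    simp only [NNReal.coe_one, mul_one, sub_zero, mul_assoc, ← Real.exp_add]
    congr 2
    ring
  simp_rw [heq]
  rw [← ofReal_integral_eq_lintegral_ofReal ((integrable_exp_neg_mul_sq hb).const_mul _)
    (ae_of_all _ fun _ => by positivity), integral_const_mul, integral_gaussian,
    ENNReal.ofReal_le_one]
  have hpi := Real.pi_pos
  have h1 : (Real.sqrt (2 * Real.pi))⁻¹ * Real.sqrt (Real.pi / (1 / 2 - t)) =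
      Real.sqrt ((1 - 2 * t)⁻¹) := by
    rw [← Real.sqrt_inv, ← Real.sqrt_mul (by positivity)]
    congr 1
    have : 1 - 2 * t ≠ 0 := by linarith
    field_simp
  have h2 : Real.exp (-t - 4 * t ^ 2) = Real.sqrt (Real.exp (-(2 * t + 8 * t ^ 2))) := by
    rw [← Real.exp_half]
    congr 1; ring
  rw [mul_right_comm, h1, h2, ← Real.sqrt_mul (by rw [inv_nonneg]; linarith), Real.exp_neg, ← mul_inv]
  rw [Real.sqrt_le_one]
  apply inv_le_one_of_one_le₀
  have h3 := Real.add_one_le_exp (2 * t + 8 * t ^ 2)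
  calc (1 : ℝ) ≤ (1 - 2 * t) * (2 * t + 8 * t ^ 2 + 1) := by nlinarith [sq_nonneg t]
    _ ≤ _ := mul_le_mul_of_nonneg_left h3 (by linarith)

/-- Given U = u, tuG is centred Gaussian with variance (tu)², so compensating by (tu)²/2 already
gives mean 1. No moment of U is needed. -/
theorem lintegral_exp_mul_mul_sub_le {Ω : Type*} [MeasurableSpace Ω] {P : Measure Ω}
    [IsProbabilityMeasure P] {U G : Ω → ℝ} (hU : AEMeasurable U P)
    (hG : HasLaw G (gaussianReal 0 1) P) (hUG : IndepFun U G P) (t : ℝ) :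
    ∫⁻ ω, ENNReal.ofReal (Real.exp (t * (U ω * G ω) - t ^ 2 * U ω ^ 2)) ∂P ≤ 1 := by
  have hmap := (indepFun_iff_map_prod_eq_prod_map_map hU hG.aemeasurable).1 hUG
  have : IsProbabilityMeasure (P.map U) := Measure.isProbabilityMeasure_map hU
  calc ∫⁻ ω, ENNReal.ofReal (Real.exp (t * (U ω * G ω) - t ^ 2 * U ω ^ 2)) ∂P
      ≤ ∫⁻ ω, ENNReal.ofReal
          (Real.exp (t * U ω * G ω - (t * U ω) ^ 2 / 2)) ∂P := by
        refine lintegral_mono fun ω => ENNReal.ofReal_le_ofReal (Real.exp_le_exp.2 ?_)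
        nlinarith [sq_nonneg (t * U ω)]
    _ = ∫⁻ x : ℝ × ℝ, ENNReal.ofReal (Real.exp (t * x.1 * x.2 - (t * x.1) ^ 2 / 2))
          ∂((P.map U).prod (P.map G)) := by
        rw [← hmap, lintegral_map' (by fun_prop) (hU.prodMk hG.aemeasurable)]
    _ = ∫⁻ u, ∫⁻ g, ENNReal.ofReal (Real.exp (t * u * g - (t * u) ^ 2 / 2))
          ∂(gaussianReal 0 1) ∂(P.map U) := by
        rw [hG.map_eq, lintegral_prod _ (by fun_prop)]
    _ = 1 := by simp [lintegral_exp_mul_sub_gaussian]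
    _ ≤ 1 := le_rfl

/-! ### Courant–Fischer bounds -/

namespace Matrix.IsHermitian

variable {n : Type*} [Fintype n] [DecidableEq n] {A : Matrix n n ℝ}

/-- Orthogonality to the eigenvectors indexed by T imposes too few linear conditions to annihilate
W; the sums are Parseval in the eigenbasis. -/
theorem exists_mem_dotProduct_eq_sum (hA : A.IsHermitian) (T : Finset n)
    (W : Submodule ℝ (n → ℝ)) (h : T.card < Module.finrank ℝ W) :
    ∃ x ∈ W, x ≠ 0 ∧ ∃ c : n → ℝ, (∀ j ∈ T, c j = 0) ∧ x ⬝ᵥ x = ∑ j, c j ^ 2 ∧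
      x ⬝ᵥ A.mulVec x = ∑ j, hA.eigenvalues j * c j ^ 2 := by
  set b := hA.eigenvectorBasis
  let φ : (n → ℝ) →ₗ[ℝ] (T → ℝ) := LinearMap.pi fun j => dotProductBilin ℝ ℝ (b j).ofLp
  have hker : (φ ∘ₗ W.subtype).ker ≠ ⊥ := LinearMap.ker_ne_bot_of_finrank_lt (by simpa using h)
  obtain ⟨⟨x, hxW⟩, hx, hx0⟩ := (Submodule.ne_bot_iff _).1 hker
  have hφ : ∀ j ∈ T, (b j).ofLp ⬝ᵥ x = 0 := fun j hj => congrFun hx ⟨j, hj⟩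
  have parseval : ∀ y, x ⬝ᵥ y = ∑ j, ((b j).ofLp ⬝ᵥ x) * ((b j).ofLp ⬝ᵥ y) := fun y => by
    have := b.sum_inner_mul_inner (WithLp.toLp 2 x) (WithLp.toLp 2 y)
    simp only [EuclideanSpace.inner_eq_star_dotProduct, star_trivial] at this
    rw [dotProduct_comm x y, ← this]
    exact Finset.sum_congr rfl fun j _ => by rw [dotProduct_comm y]
  refine ⟨x, hxW, fun h => hx0 (Subtype.ext h), fun j => (b j).ofLp ⬝ᵥ x, hφ, ?_, ?_⟩
  · rw [parseval]
    exact Finset.sum_congr rfl fun j _ => (sq _).symm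
  · rw [parseval]
    refine Finset.sum_congr rfl fun j _ => ?_
    have hT : Aᵀ = A := by simpa [conjTranspose] using hA.eq
    rw [dotProduct_mulVec, ← mulVec_transpose, hT, hA.mulVec_eigenvectorBasis, smul_dotProduct,
      smul_eq_mul]
    ring

variable (hA : A.IsHermitian)

/-- Lower half of the Courant–Fischer principle. -/
theorem le_eigenvalues₀_of_submodule {W : Submodule ℝ (n → ℝ)} {c : ℝ}
    (hW : ∀ x ∈ W, c * (x ⬝ᵥ x) ≤ x ⬝ᵥ A.mulVec x) {i : Fin (Fintype.card n)}
    (hi : i.val < Module.finrank ℝ W) : c ≤ hA.eigenvalues₀ i := by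
  -- `eigenvalues` is `eigenvalues₀` reindexed along e. Removing the i eigenvectors ranked before i
  -- leaves only eigenvalues at most the i-th.
  set e := (Fintype.equivOfCardEq (Fintype.card_fin (Fintype.card n))).symm with he
  obtain ⟨x, hxW, hx0, d, hd, h1, h2⟩ := hA.exists_mem_dotProduct_eq_sum
    ((Finset.Iio i).map e.symm.toEmbedding) W (by simpa using hi)
  have hpos : 0 < x ⬝ᵥ x := dotProduct_self_star_pos_iff.2 hx0
  have h3 : x ⬝ᵥ A.mulVec x ≤ hA.eigenvalues₀ i * (x ⬝ᵥ x) := by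
    rw [h1, h2, Finset.mul_sum]
    refine Finset.sum_le_sum fun j _ => ?_
    by_cases hj : e j < i
    · simp [hd j (by simpa using hj)]
    · exact mul_le_mul_of_nonneg_right (hA.eigenvalues₀_antitone (not_lt.1 hj)) (sq_nonneg _)
  exact le_of_mul_le_mul_right ((hW x hxW).trans h3) hpos

/-- Upper half of the Courant–Fischer principle. -/
theorem eigenvalues₀_le_of_submodule {W : Submodule ℝ (n → ℝ)} {c : ℝ}
    (hW : ∀ x ∈ W, x ⬝ᵥ A.mulVec x ≤ c * (x ⬝ᵥ x)) {i : Fin (Fintype.card n)}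
    (hi : Fintype.card n ≤ i.val + Module.finrank ℝ W) : hA.eigenvalues₀ i ≤ c := by
  set e := (Fintype.equivOfCardEq (Fintype.card_fin (Fintype.card n))).symm with he
  obtain ⟨x, hxW, hx0, d, hd, h1, h2⟩ := hA.exists_mem_dotProduct_eq_sum
    ((Finset.Ioi i).map e.symm.toEmbedding) W (by
      have := i.2
      simp
      omega)
  have hpos : 0 < x ⬝ᵥ x := dotProduct_self_star_pos_iff.2 hx0
  have h3 : hA.eigenvalues₀ i * (x ⬝ᵥ x) ≤ x ⬝ᵥ A.mulVec x := by
    rw [h1, h2, Finset.mul_sum]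
    refine Finset.sum_le_sum fun j _ => ?_
    by_cases hj : i < e j
    · simp [hd j (by simpa using hj)]
    · exact mul_le_mul_of_nonneg_right (hA.eigenvalues₀_antitone (not_lt.1 hj)) (sq_nonneg _)
  exact le_of_mul_le_mul_right (h3.trans (hW x hxW)) hpos

end Matrix.IsHermitian

/-! ### Quadratic forms and eigenvalues of the sample covariance -/

/-- The Rayleigh quotient is scale invariant and attains a positive minimum on the compact unit
sphere of W. The sphere is for the sup norm, hence the quotient. -/
theorem Submodule.exists_pos_mul_dotProduct_le {n : Type*} [Fintype n] (B : Matrix n n ℝ)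
    (W : Submodule ℝ (n → ℝ)) (h : ∀ y ∈ W, y ≠ 0 → 0 < y ⬝ᵥ B.mulVec y) :
    ∃ κ > 0, ∀ y ∈ W, κ * (y ⬝ᵥ y) ≤ y ⬝ᵥ B.mulVec y := by
  set S : Set (n → ℝ) := Metric.sphere 0 1 ∩ W
  have hne : ∀ y ∈ S, y ≠ 0 := by
    rintro y ⟨hy, -⟩ rfl
    simp at hy
  have hpos : ∀ y : n → ℝ, y ≠ 0 → 0 < y ⬝ᵥ y := fun y hy =>
    Matrix.dotProduct_self_star_pos_iff.2 hy
  have hScomp : IsCompact S :=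
    (isCompact_sphere 0 1).inter_right (Submodule.closed_of_finiteDimensional W)
  have hscale : ∀ y ∈ W, y ≠ 0 → ‖y‖⁻¹ • y ∈ S := fun y hy hy0 => by
    refine ⟨?_, W.smul_mem _ hy⟩
    simp [norm_smul, hy0]
  rcases S.eq_empty_or_nonempty with hS | hS
  · refine ⟨1, one_pos, fun y hy => ?_⟩
    have hy0 : y = 0 := by
      by_contra hy0
      simpa [hS] using hscale y hy hy0
    simp [hy0]
  · obtain ⟨y₀, hy₀, hmin⟩ := hScomp.exists_isMinOn (f := fun y => (y ⬝ᵥ B.mulVec y) / (y ⬝ᵥ y)) hS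
      (ContinuousOn.div (by fun_prop) (by fun_prop) fun y hy => (hpos y (hne y hy)).ne')
    refine ⟨_, div_pos (h y₀ hy₀.2 (hne y₀ hy₀)) (hpos y₀ (hne y₀ hy₀)), fun y hy => ?_⟩
    by_cases hy0 : y = 0
    · simp [hy0]
    have hm := hmin (hscale y hy hy0)
    have hn : 0 < ‖y‖ := norm_pos_iff.2 hy0
    simp only [Set.mem_ofPred_eq, Matrix.mulVec_smul, dotProduct_smul, smul_dotProduct, smul_eq_mul]
      at hm
    rw [le_div_iff₀ (by have := hpos y hy0; positivity)] at hm
    have h2 : 0 < ‖y‖⁻¹ * ‖y‖⁻¹ := by positivity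
    refine le_of_mul_le_mul_left ?_ h2
    nlinarith [hm]

theorem abs_sum_sum_mul_le {m n : Type*} [Fintype m] [Fintype n] {E : m → n → ℝ} {ε : ℝ}
    (hE : ∀ a b, |E a b| ≤ ε) (u : m → ℝ) (v : n → ℝ) :
    |∑ a, ∑ b, u a * v b * E a b| ≤ ε * ((∑ a, |u a|) * ∑ b, |v b|) := by
  calc |∑ a, ∑ b, u a * v b * E a b| ≤ ∑ a, ∑ b, |u a * v b * E a b| :=
        (Finset.abs_sum_le_sum_abs _ _).trans
          (Finset.sum_le_sum fun a _ => Finset.abs_sum_le_sum_abs _ _)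
    _ ≤ ∑ a, ∑ b, |u a| * |v b| * ε := by
        refine Finset.sum_le_sum fun a _ => Finset.sum_le_sum fun b _ => ?_
        rw [abs_mul, abs_mul]
        exact mul_le_mul_of_nonneg_left (hE a b) (by positivity)
    _ = _ := by
        rw [Finset.sum_mul_sum, Finset.mul_sum]
        refine Finset.sum_congr rfl fun a _ => ?_
        rw [Finset.mul_sum]
        exact Finset.sum_congr rfl fun b _ => by ring

theorem sq_sum_abs_le {n : Type*} [Fintype n] (y : n → ℝ) :
    (∑ b, |y b|) * ∑ b, |y b| ≤ Fintype.card n * (y ⬝ᵥ y) := by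
  have := sq_sum_le_card_mul_sum_sq (s := Finset.univ) (f := fun b => |y b|)
  simpa [sq, dotProduct] using this

theorem sum_abs_transpose_mulVec_le {m n : Type*} [Fintype m] [Fintype n] (M : Matrix m n ℝ)
    (y : m → ℝ) :
    ∑ a, |M.transpose.mulVec y a| ≤ (∑ a, ∑ b, |M b a|) * ∑ b, |y b| := by
  rw [Finset.sum_mul]
  refine Finset.sum_le_sum fun a _ => ?_
  rw [Finset.sum_mul]
  refine (Finset.abs_sum_le_sum_abs _ _).trans (Finset.sum_le_sum fun b _ => ?_)
  change |M b a * y b| ≤ _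
  rw [abs_mul]
  exact mul_le_mul_of_nonneg_left
    (Finset.single_le_sum (f := fun b => |y b|) (fun _ _ => abs_nonneg _) (Finset.mem_univ b))
    (abs_nonneg _)

theorem dotProduct_sampleCov_mulVec {p : ℕ} (x : ℕ → Fin p → ℝ) (n : ℕ) (y : Fin p → ℝ) :
    y ⬝ᵥ (sampleCov x n).mulVec y = (∑ i ∈ Finset.range n, (y ⬝ᵥ x i) ^ 2) / n := by
  simp only [sampleCov, Matrix.smul_mulVec, Matrix.sum_mulVec, dotProduct_smul, dotProduct_sum,
    Matrix.vecMulVec_mulVec]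
  rw [smul_eq_mul, one_div, inv_mul_eq_div]
  congr 1
  refine Finset.sum_congr rfl fun i _ => ?_
  simp [dotProduct_comm (x i) y, sq]

theorem sum_dotProduct_mul_dotProduct {m n : Type*} [Fintype m] [Fintype n] (u : m → ℝ)
    (v : n → ℝ) (s : ℕ → m → ℝ) (z : ℕ → n → ℝ) (N : ℕ) :
    ∑ i ∈ Finset.range N, (u ⬝ᵥ s i) * (v ⬝ᵥ z i) =
      ∑ a, ∑ b, u a * v b * ∑ i ∈ Finset.range N, s i a * z i b := by
  simp_rw [dotProduct, Finset.sum_mul_sum]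
  rw [Finset.sum_comm]
  refine Finset.sum_congr rfl fun a _ => ?_
  rw [Finset.sum_comm]
  refine Finset.sum_congr rfl fun b _ => ?_
  rw [Finset.mul_sum]
  exact Finset.sum_congr rfl fun i _ => by ring

section

variable {p q : ℕ} {M : Matrix (Fin p) (Fin q) ℝ} {σ : ℝ} {s : ℕ → Fin q → ℝ} {z : ℕ → Fin p → ℝ}

/-- Expand (y·x_i)² with y·x_i = Mᵀy·s_i + √σ y·z_i. The signal square is kept exactly; only the
cross term and the centred noise square are estimated. -/
theorem abs_sampleCov_quadForm_sub_le (hσ : 0 ≤ σ) {n : ℕ} (hn : 0 < n) {ε : ℝ} (hε : 0 ≤ ε)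
    (hsz : ∀ a b, |∑ i ∈ Finset.range n, s i a * z i b| ≤ ε)
    (hzz : ∀ b b', |∑ i ∈ Finset.range n, (z i b * z i b' - if b = b' then 1 else 0)| ≤ ε)
    (y : Fin p → ℝ) :
    |y ⬝ᵥ (sampleCov (fun i => observation M σ (s i) (z i)) n).mulVec y
      - (∑ i ∈ Finset.range n, (M.transpose.mulVec y ⬝ᵥ s i) ^ 2) / n - σ * (y ⬝ᵥ y)| ≤
      (2 * Real.sqrt σ * (∑ a, ∑ b, |M b a|) + σ) * p * (ε / n) * (y ⬝ᵥ y) := by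
  have hn' : (0 : ℝ) < n := by exact_mod_cast hn
  set u := M.transpose.mulVec y with hu
  set m := ∑ a, ∑ b, |M b a|
  set Q := ∑ i ∈ Finset.range n, (u ⬝ᵥ s i) ^ 2
  set H := ∑ a, ∑ b, u a * y b * ∑ i ∈ Finset.range n, s i a * z i b with hH
  set Z := ∑ a, ∑ b, y a * y b * ∑ i ∈ Finset.range n, (z i a * z i b - if a = b then 1 else 0)
    with hZ
  have hHle : |H| ≤ ε * (m * (p * (y ⬝ᵥ y))) := by
    refine (abs_sum_sum_mul_le hsz u y).trans ?_
    have h1 := sum_abs_transpose_mulVec_le M y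
    have h2 := sq_sum_abs_le y
    rw [Fintype.card_fin] at h2
    refine mul_le_mul_of_nonneg_left ?_ hε
    calc (∑ a, |u a|) * ∑ b, |y b| ≤ (m * ∑ b, |y b|) * ∑ b, |y b| := by gcongr
      _ = m * ((∑ b, |y b|) * ∑ b, |y b|) := by ring
      _ ≤ _ := by gcongr
  have hZle : |Z| ≤ ε * (p * (y ⬝ᵥ y)) := by
    refine (abs_sum_sum_mul_le hzz y y).trans ?_
    have h2 := sq_sum_abs_le y
    rw [Fintype.card_fin] at h2
    gcongr
  have hZeq : ∑ i ∈ Finset.range n, (y ⬝ᵥ z i) ^ 2 = Z + n * (y ⬝ᵥ y) := by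
    have h1 := sum_dotProduct_mul_dotProduct y y z z n
    have h2 : n * (y ⬝ᵥ y) = ∑ a, ∑ b, y a * y b * ∑ i ∈ Finset.range n,
        (if a = b then (1 : ℝ) else 0) := by
      simp [dotProduct, Finset.mul_sum, mul_comm]
    simp_rw [sq]
    rw [h1, hZ, h2, ← Finset.sum_add_distrib]
    refine Finset.sum_congr rfl fun a _ => ?_
    rw [← Finset.sum_add_distrib]
    refine Finset.sum_congr rfl fun b _ => ?_
    rw [Finset.sum_sub_distrib]
    ring
  have hexpand : ∑ i ∈ Finset.range n, (y ⬝ᵥ observation M σ (s i) (z i)) ^ 2 =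
      Q + 2 * Real.sqrt σ * H + σ * (Z + n * (y ⬝ᵥ y)) := by
    rw [← hZeq, hH, ← sum_dotProduct_mul_dotProduct, Finset.mul_sum, Finset.mul_sum,
      ← Finset.sum_add_distrib, ← Finset.sum_add_distrib]
    refine Finset.sum_congr rfl fun i _ => ?_
    have : y ⬝ᵥ observation M σ (s i) (z i) = u ⬝ᵥ s i + Real.sqrt σ * (y ⬝ᵥ z i) := by
      rw [observation, dotProduct_add, dotProduct_smul, smul_eq_mul, Matrix.dotProduct_mulVec,
        ← Matrix.mulVec_transpose]
    rw [this]
    linear_combination (y ⬝ᵥ z i) ^ 2 * Real.sq_sqrt hσ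
  rw [dotProduct_sampleCov_mulVec, hexpand]
  have : (Q + 2 * Real.sqrt σ * H + σ * (Z + n * (y ⬝ᵥ y))) / n - Q / n - σ * (y ⬝ᵥ y) =
      (2 * Real.sqrt σ * H + σ * Z) / n := by
    field_simp
    ring
  rw [this, abs_div, abs_of_pos hn', div_le_iff₀ hn']
  calc |2 * Real.sqrt σ * H + σ * Z| ≤ 2 * Real.sqrt σ * |H| + σ * |Z| := by
        refine (abs_add_le _ _).trans (le_of_eq ?_)
        rw [abs_mul, abs_mul, abs_mul, abs_of_nonneg hσ, abs_of_nonneg (Real.sqrt_nonneg σ), abs_two]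
    _ ≤ 2 * Real.sqrt σ * (ε * (m * (p * (y ⬝ᵥ y)))) + σ * (ε * (p * (y ⬝ᵥ y))) := by gcongr
    _ = _ := by field_simp

theorem exists_pos_eventually_le_signal_quadForm
    {Γ : Matrix (Fin q) (Fin q) ℝ} (hΓ : Γ.PosDef)
    (hss : ∀ a a', Tendsto (fun n : ℕ => (∑ i ∈ Finset.range n, s i a * s i a') / n) atTop
      (𝓝 (Γ a a'))) :
    ∃ κ > 0, ∀ᶠ n : ℕ in atTop, ∀ y ∈ LinearMap.range M.mulVecLin,
      κ * (y ⬝ᵥ y) ≤ (∑ i ∈ Finset.range n, (M.transpose.mulVec y ⬝ᵥ s i) ^ 2) / n := by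
  obtain ⟨κ, hκ, h⟩ := Submodule.exists_pos_mul_dotProduct_le (M * Γ * M.transpose)
    (LinearMap.range M.mulVecLin) (by
      rintro y ⟨w, rfl⟩ hy0
      rw [← Matrix.mulVec_mulVec, ← Matrix.mulVec_mulVec, Matrix.dotProduct_mulVec,
        ← Matrix.mulVec_transpose]
      -- The range of M meets ker Mᵀ only in 0.
      have hne : M.transpose.mulVec (M.mulVecLin w) ≠ 0 := by
        intro h0
        apply hy0
        rw [← dotProduct_self_eq_zero]
        nth_rewrite 2 [Matrix.mulVecLin_apply]
        rw [Matrix.dotProduct_mulVec, ← Matrix.mulVec_transpose, h0, zero_dotProduct]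
      simpa using hΓ.dotProduct_mulVec_pos hne)
  set m := ∑ a, ∑ b, |M b a|
  have hm : 0 ≤ m := by positivity
  -- Since (∑|(Mᵀy)_a|)² ≤ m²p(y·y), this entrywise tolerance costs at most half of κ; the + 1
  -- avoids a zero denominator.
  have hδ : 0 < κ / 2 / (m * m * p + 1) := by positivity
  refine ⟨κ / 2, by positivity, ?_⟩
  have hclose : ∀ᶠ n : ℕ in atTop, ∀ a a',
      |(∑ i ∈ Finset.range n, s i a * s i a') / n - Γ a a'| ≤ κ / 2 / (m * m * p + 1) := by
    simp_rw [eventually_all]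
    intro a a'
    filter_upwards [(hss a a').eventually (Metric.closedBall_mem_nhds _ hδ)] with n hn
    simpa [Real.dist_eq] using hn
  filter_upwards [hclose] with n hn y hy
  set u := M.transpose.mulVec y with hu
  have hle := (abs_le.1 (abs_sum_sum_mul_le hn u u)).1
  have hquad : y ⬝ᵥ (M * Γ * M.transpose).mulVec y = ∑ a, ∑ b, u a * u b * Γ a b := by
    rw [← Matrix.mulVec_mulVec, ← Matrix.mulVec_mulVec, Matrix.dotProduct_mulVec,
        ← Matrix.mulVec_transpose, ← hu]
    simp only [dotProduct, Matrix.mulVec, Finset.mul_sum]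
    exact Finset.sum_congr rfl fun a _ => Finset.sum_congr rfl fun b _ => by ring
  have hsplit : ∑ a, ∑ b, u a * u b * ((∑ i ∈ Finset.range n, s i a * s i b) / n - Γ a b) =
      (∑ i ∈ Finset.range n, (u ⬝ᵥ s i) ^ 2) / n - y ⬝ᵥ (M * Γ * M.transpose).mulVec y := by
    simp_rw [sq]
    rw [hquad, sum_dotProduct_mul_dotProduct, Finset.sum_div, ← Finset.sum_sub_distrib]
    refine Finset.sum_congr rfl fun a _ => ?_
    rw [Finset.sum_div, ← Finset.sum_sub_distrib]
    exact Finset.sum_congr rfl fun b _ => by ring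
  rw [hsplit] at hle
  have hyy : 0 ≤ y ⬝ᵥ y := dotProduct_self_star_nonneg y
  have hup : (∑ a, |u a|) * (∑ b, |u b|) ≤ m * m * p * (y ⬝ᵥ y) := by
    have h1 := sum_abs_transpose_mulVec_le M y
    have h2 := sq_sum_abs_le y
    rw [Fintype.card_fin] at h2
    calc (∑ a, |u a|) * (∑ b, |u b|) ≤ (m * ∑ b, |y b|) * (m * ∑ b, |y b|) := by gcongr
      _ = m * m * ((∑ b, |y b|) * ∑ b, |y b|) := by ring
      _ ≤ m * m * (p * (y ⬝ᵥ y)) := by gcongr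
      _ = _ := by ring
  have hsmall : κ / 2 / (m * m * p + 1) * ((∑ a, |u a|) * (∑ b, |u b|)) ≤ κ / 2 * (y ⬝ᵥ y) := by
    calc _ ≤ κ / 2 / (m * m * p + 1) * ((m * m * p + 1) * (y ⬝ᵥ y)) :=
          mul_le_mul_of_nonneg_left (by linarith) hδ.le
      _ = _ := by field_simp
  have := h y hy
  linarith

/-- The largest `q` sample eigenvalues stay away from the noise level, and the others approach it
at the rate of the law of the iterated logarithm. -/
theorem sampleEig_asymptotics (hM : LinearIndependent ℝ M.col) (hσ : 0 < σ)
    {Γ : Matrix (Fin q) (Fin q) ℝ} (hΓ : Γ.PosDef) {r : ℕ → ℝ}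
    (hr : Tendsto (fun n : ℕ => r n / n) atTop (𝓝 0)) (hr0 : ∀ n, 0 ≤ r n)
    (hss : ∀ a a', Tendsto (fun n : ℕ => (∑ i ∈ Finset.range n, s i a * s i a') / n) atTop
      (𝓝 (Γ a a')))
    (hsz : ∀ a b, ∃ c, ∀ᶠ n : ℕ in atTop, |∑ i ∈ Finset.range n, s i a * z i b| ≤ c * r n)
    (hzz : ∀ b b', ∃ c, ∀ᶠ n : ℕ in atTop,
      |∑ i ∈ Finset.range n, (z i b * z i b' - if b = b' then 1 else 0)| ≤ c * r n) :
    (∃ κ > 0, ∀ᶠ n : ℕ in atTop, ∀ i : Fin p, i.val < q →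
      σ + κ ≤ sampleEig (fun i => observation M σ (s i) (z i)) n i) ∧
    ∃ D, ∀ᶠ n : ℕ in atTop, ∀ i : Fin p, q ≤ i.val →
      |sampleEig (fun i => observation M σ (s i) (z i)) n i - σ| ≤ D * (r n / n) := by
  choose c hc using hsz
  choose d hd using hzz
  -- A single constant dominating the finitely many entrywise ones.
  set e := (∑ a, ∑ b, |c a b|) + ∑ b, ∑ b', |d b b'| with he
  have hce : ∀ a b, c a b ≤ e := fun a b => by
    have h1 := Finset.single_le_sum (f := fun b => |c a b|) (fun _ _ => abs_nonneg _)
      (Finset.mem_univ b)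
    have h2 := Finset.single_le_sum (f := fun a => ∑ b, |c a b|)
      (fun _ _ => Finset.sum_nonneg fun _ _ => abs_nonneg _) (Finset.mem_univ a)
    have h3 : 0 ≤ ∑ b, ∑ b', |d b b'| := by positivity
    have := le_abs_self (c a b)
    linarith
  have hde : ∀ a b, d a b ≤ e := fun a b => by
    have h1 := Finset.single_le_sum (f := fun b => |d a b|) (fun _ _ => abs_nonneg _)
      (Finset.mem_univ b)
    have h2 := Finset.single_le_sum (f := fun a => ∑ b, |d a b|)
      (fun _ _ => Finset.sum_nonneg fun _ _ => abs_nonneg _) (Finset.mem_univ a)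
    have h3 : 0 ≤ ∑ b, ∑ b', |c b b'| := by positivity
    have := le_abs_self (d a b)
    linarith
  have he0 : 0 ≤ e := by positivity
  set D := (2 * Real.sqrt σ * (∑ a, ∑ b, |M b a|) + σ) * p * e with hD
  have hquad : ∀ᶠ n : ℕ in atTop, ∀ y : Fin p → ℝ,
      |y ⬝ᵥ (sampleCov (fun i => observation M σ (s i) (z i)) n).mulVec y
        - (∑ i ∈ Finset.range n, (M.transpose.mulVec y ⬝ᵥ s i) ^ 2) / n - σ * (y ⬝ᵥ y)| ≤
        D * (r n / n) * (y ⬝ᵥ y) := by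
    filter_upwards [eventually_all.2 fun a => eventually_all.2 (hc a),
      eventually_all.2 fun a => eventually_all.2 (hd a), eventually_gt_atTop 0] with n hcn hdn hn y
    have := abs_sampleCov_quadForm_sub_le (M := M) hσ.le hn (mul_nonneg he0 (hr0 n))
      (fun a b => (hcn a b).trans (mul_le_mul_of_nonneg_right (hce a b) (hr0 n)))
      (fun a b => (hdn a b).trans (mul_le_mul_of_nonneg_right (hde a b) (hr0 n))) y
    refine this.trans (le_of_eq ?_)
    rw [hD]; ring
  have hinj : Function.Injective M.mulVecLin := Matrix.mulVec_injective_iff.2 hM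
  have hrange : Module.finrank ℝ (LinearMap.range M.mulVecLin) = q := by
    rw [LinearMap.finrank_range_of_inj hinj]; simp
  have hker : p ≤ q + Module.finrank ℝ (LinearMap.ker M.transpose.mulVecLin) := by
    have h1 := M.transpose.mulVecLin.finrank_range_add_finrank_ker
    have h2 := Submodule.finrank_le (LinearMap.range M.transpose.mulVecLin)
    simp only [Module.finrank_fintype_fun_eq_card, Fintype.card_fin] at h1 h2
    omega
  constructor
  · obtain ⟨κ, hκ, hsig⟩ := exists_pos_eventually_le_signal_quadForm (M := M) hΓ hss
    refine ⟨κ / 2, by positivity, ?_⟩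
    have hsmall : ∀ᶠ n : ℕ in atTop, D * (r n / n) ≤ κ / 2 := by
      have := hr.const_mul D
      rw [mul_zero] at this
      exact this.eventually_le_const (by positivity)
    filter_upwards [hquad, hsig, hsmall] with n hq hs hn i hi
    refine Matrix.IsHermitian.le_eigenvalues₀_of_submodule _
      (W := LinearMap.range M.mulVecLin) (fun y hy => ?_) (by simpa [hrange] using hi)
    have h1 := (abs_le.1 (hq y)).1
    have h2 := hs y hy
    have h3 : 0 ≤ y ⬝ᵥ y := dotProduct_self_star_nonneg y
    nlinarith
  · refine ⟨D, ?_⟩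
    filter_upwards [hquad] with n hq i hi
    rw [abs_le]
    constructor
    -- The signal form is nonnegative on the whole space.
    · rw [neg_le_sub_iff_le_add, ← sub_le_iff_le_add]
      refine Matrix.IsHermitian.le_eigenvalues₀_of_submodule _ (W := ⊤) (fun y _ => ?_)
        (by simp)
      have h1 := (abs_le.1 (hq y)).1
      have h2 : 0 ≤ (∑ i ∈ Finset.range n, (M.transpose.mulVec y ⬝ᵥ s i) ^ 2) / n := by positivity
      linarith
    -- The signal form vanishes on ker Mᵀ, of dimension at least p - q.
    · rw [sub_le_iff_le_add]
      refine Matrix.IsHermitian.eigenvalues₀_le_of_submodule _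
        (W := LinearMap.ker M.transpose.mulVecLin) (fun y hy => ?_) (by
          simp only [Fintype.card_fin, Fin.val_cast]; omega)
      have h1 := (abs_le.1 (hq y)).2
      have h2 : M.transpose.mulVec y = 0 := hy
      simp only [h2, zero_dotProduct] at h1
      norm_num at h1
      linarith

end

/-! ### Comparison of criterion values -/

theorem tendsto_log_log_natCast : Tendsto (fun n : ℕ => Real.log (Real.log n)) atTop atTop :=
  Real.tendsto_log_atTop.comp tendsto_log_natCast

theorem tendsto_sqrt_mul_log_log_div :
    Tendsto (fun n : ℕ => Real.sqrt (n * Real.log (Real.log n)) / n) atTop (𝓝 0) := by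
  have h1 : Tendsto (fun n : ℕ => Real.log n / n) atTop (𝓝 0) := by
    have := (Real.isLittleO_log_id_atTop.tendsto_div_nhds_zero).comp
      (tendsto_natCast_atTop_atTop (R := ℝ))
    exact this
  have h2 := h1.sqrt
  rw [Real.sqrt_zero] at h2
  refine squeeze_zero' (Eventually.of_forall fun n => by positivity) ?_ h2
  filter_upwards [eventually_gt_atTop 0, tendsto_log_natCast.eventually_ge_atTop 0] with n hn hl
  have hn' : (0 : ℝ) < n := by exact_mod_cast hn
  rw [div_le_iff₀ hn', Real.sqrt_le_left (by positivity), mul_pow, Real.sq_sqrt (by positivity)]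
  have := Real.log_le_self hl
  calc n * Real.log (Real.log n) ≤ n * Real.log n := by gcongr
    _ = _ := by field_simp

section

variable {p q k : ℕ} {σ : ℝ} {x : ℕ → Fin p → ℝ} {C : ℕ → ℝ}

theorem eventually_IC_lt_of_lt (hσ : 0 < σ) (hqp : q ≤ p) (hkq : k < q) {κ : ℝ} (hκ : 0 < κ)
    (hbig : ∀ᶠ n : ℕ in atTop, ∀ i : Fin p, i.val < q → σ + κ ≤ sampleEig x n i)
    (hC : Tendsto (fun n : ℕ => C n / (n : ℝ)) atTop (𝓝 0)) :
    ∀ᶠ n : ℕ in atTop, IC σ (C n) x n q < IC σ (C n) x n k := by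
  set b : ℝ := ((p : ℝ) - k) * ((p : ℝ) - k - 1) / 2 - ((p : ℝ) - q) * ((p : ℝ) - q - 1) / 2
    with hb
  have hlim := hC.mul_const b
  rw [zero_mul] at hlim
  have hpos : 0 < 1 / (2 * σ ^ 2) * κ ^ 2 := by positivity
  filter_upwards [hbig, hlim.eventually_lt_const hpos, eventually_gt_atTop 0] with n hn hCn hn0
  have hn' : (0 : ℝ) < n := by exact_mod_cast hn0
  have hkp : k < p := by omega
  -- The single index k < q, absent from the sum for q, already contributes κ².
  have hsum : (∑ i : Fin p with q ≤ i.val, (sampleEig x n i - σ) ^ 2) + κ ^ 2 ≤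
      ∑ i : Fin p with k ≤ i.val, (sampleEig x n i - σ) ^ 2 := by
    have hnot : (⟨k, hkp⟩ : Fin p) ∉ Finset.univ.filter fun i : Fin p => q ≤ i.val := by
      simpa using hkq
    have h1 : κ ^ 2 ≤ (sampleEig x n ⟨k, hkp⟩ - σ) ^ 2 := by
      have := hn ⟨k, hkp⟩ hkq
      exact pow_le_pow_left₀ hκ.le (by linarith) 2
    refine (add_le_add_right h1 _).trans ?_
    rw [add_comm, ← Finset.sum_insert hnot (f := fun i => (sampleEig x n i - σ) ^ 2)]
    refine Finset.sum_le_sum_of_subset_of_nonneg ?_ fun i _ _ => sq_nonneg _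
    intro i hi
    simp only [Finset.mem_insert, Finset.mem_filter, Finset.mem_univ, true_and] at hi ⊢
    rcases hi with rfl | hi
    · exact le_rfl
    · omega
  have h2 := mul_le_mul_of_nonneg_left hsum (show 0 ≤ (n : ℝ) / (2 * σ ^ 2) by positivity)
  have h3 : C n * b < n / (2 * σ ^ 2) * κ ^ 2 := by
    have h4 := mul_lt_mul_of_pos_left hCn hn'
    have h5 : (n : ℝ) * (C n / n * b) = C n * b := by field_simp
    have h6 : (n : ℝ) * (1 / (2 * σ ^ 2) * κ ^ 2) = n / (2 * σ ^ 2) * κ ^ 2 := by ring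
    rwa [h5, h6] at h4
  unfold IC
  rw [hb] at h3
  linarith

theorem eventually_IC_lt_of_gt (hσ : 0 < σ) (hkq : q < k) (hkp : k ≤ p)
    (hne : ¬ (q + 1 = p ∧ k = p)) {D : ℝ}
    (hsmall : ∀ᶠ n : ℕ in atTop, ∀ i : Fin p, q ≤ i.val →
      |sampleEig x n i - σ| ≤ D * (Real.sqrt (n * Real.log (Real.log n)) / n))
    (hC : Tendsto (fun n : ℕ => C n / Real.log (Real.log (n : ℝ))) atTop atTop) :
    ∀ᶠ n : ℕ in atTop, IC σ (C n) x n q < IC σ (C n) x n k := by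
  set b : ℝ := ((p : ℝ) - q) * ((p : ℝ) - q - 1) / 2 - ((p : ℝ) - k) * ((p : ℝ) - k - 1) / 2
    with hb
  -- b = (k - q)(2p - q - k - 1)/2, whose second factor vanishes exactly in the excluded case q + 1
  -- = k = p.
  have hbpos : 0 < b := by
    have h1 : (q : ℝ) + 1 ≤ k := by exact_mod_cast hkq
    have h2 : (q : ℝ) + k + 2 ≤ 2 * p := by exact_mod_cast (by omega : q + k + 2 ≤ 2 * p)
    have : b = ((k : ℝ) - q) * (2 * p - q - k - 1) / 2 := by rw [hb]; ring
    rw [this]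
    have h3 : 0 < (k : ℝ) - q := by linarith
    have h4 : 0 < (2 * p - q - k - 1 : ℝ) := by linarith
    positivity
  -- The threshold balances b · C_n against the fit gain, at most pD² log log n / (2σ²).
  filter_upwards [hsmall, hC.eventually_gt_atTop (p * D ^ 2 / (2 * σ ^ 2) / b),
    tendsto_log_log_natCast.eventually_gt_atTop 0, eventually_gt_atTop 0] with n hn hCn hL hn0
  have hn' : (0 : ℝ) < n := by exact_mod_cast hn0
  set L := Real.log (Real.log n)
  have hsum : ∑ i : Fin p with q ≤ i.val, (sampleEig x n i - σ) ^ 2 ≤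
      (∑ i : Fin p with k ≤ i.val, (sampleEig x n i - σ) ^ 2) + p * (D ^ 2 * L / n) := by
    have hsub : (Finset.univ.filter fun i : Fin p => k ≤ i.val) ⊆
        Finset.univ.filter fun i : Fin p => q ≤ i.val :=
      Finset.monotone_filter_right _ fun i _ hi => hkq.le.trans hi
    rw [← Finset.sum_sdiff hsub, add_comm]
    gcongr
    refine (Finset.sum_le_card_nsmul _ _ (D ^ 2 * L / n) fun i hi => ?_).trans ?_
    · have hi' : q ≤ i.val := by
        simp only [Finset.mem_sdiff, Finset.mem_filter, Finset.mem_univ, true_and] at hi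
        exact hi.1
      have h1 := pow_le_pow_left₀ (abs_nonneg _) (hn i hi') 2
      rw [sq_abs, mul_pow, div_pow, Real.sq_sqrt (by positivity)] at h1
      refine h1.trans (le_of_eq ?_)
      field_simp
    · rw [nsmul_eq_mul]
      gcongr
      simpa using Finset.card_le_univ
        ((Finset.univ.filter fun i : Fin p => q ≤ i.val) \ Finset.univ.filter fun i : Fin p =>
          k ≤ i.val)
  have h2 := mul_le_mul_of_nonneg_left hsum (show 0 ≤ (n : ℝ) / (2 * σ ^ 2) by positivity)
  have h3 : n / (2 * σ ^ 2) * (p * (D ^ 2 * L / n)) < C n * b := by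
    rw [lt_div_iff₀ hL, div_mul_eq_mul_div, div_lt_iff₀ hbpos] at hCn
    refine lt_of_eq_of_lt ?_ hCn
    field_simp
  unfold IC
  rw [hb] at h3
  linarith

end

theorem tendsto_of_eventually_IC_lt {p q : ℕ} {σ : ℝ} {x : ℕ → Fin p → ℝ} {C : ℕ → ℝ}
    {K : Finset ℕ} {khat : ℕ → ℕ} (h_mem : ∀ n, khat n ∈ K)
    (h_min : ∀ n, IC σ (C n) x n (khat n) ≤ IC σ (C n) x n q)
    (h : ∀ k ∈ K, k ≠ q → ∀ᶠ n : ℕ in atTop, IC σ (C n) x n q < IC σ (C n) x n k) :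
    Tendsto khat atTop (𝓝 q) := by
  have hall : ∀ᶠ n : ℕ in atTop, ∀ k ∈ K, k ≠ q → IC σ (C n) x n q < IC σ (C n) x n k := by
    rw [Finset.eventually_all]
    intro k hk
    by_cases hkq : k = q
    · simp [hkq]
    · filter_upwards [h k hk hkq] with n hn _ using hn
  refine tendsto_const_nhds.congr' ?_
  filter_upwards [hall] with n hn
  by_contra hne
  exact (hn _ (h_mem n) (Ne.symm hne)).not_ge (h_min n)

/-! ### Almost sure rates for signal and noise sums -/

section

variable {Ω : Type*} [MeasurableSpace Ω] {P : Measure Ω} {p q : ℕ}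
  {s : ℕ → Ω → Fin q → ℝ} {z : ℕ → Ω → Fin p → ℝ}

theorem hasLaw_gaussianReal_apply {z : Ω → Fin p → ℝ}
    (hz : HasLaw z (Measure.pi fun _ : Fin p => gaussianReal 0 1) P) (b : Fin p) :
    HasLaw (fun ω => z ω b) (gaussianReal 0 1) P :=
  (measurePreserving_eval (fun _ : Fin p => gaussianReal 0 1) b).hasLaw.comp hz

theorem indepFun_apply_of_hasLaw_pi_gaussianReal [IsProbabilityMeasure P]
    {z : Ω → Fin p → ℝ}
    (hz : HasLaw z (Measure.pi fun _ : Fin p => gaussianReal 0 1) P) {b b' : Fin p} (h : b ≠ b') :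
    IndepFun (fun ω => z ω b) (fun ω => z ω b') P := by
  have hm : ∀ b, AEMeasurable (fun ω => z ω b) P := fun b =>
    (hasLaw_gaussianReal_apply hz b).aemeasurable
  have : iIndepFun (fun b ω => z ω b) P := by
    rw [iIndepFun_iff_map_fun_eq_pi_map hm]
    simp_rw [(hasLaw_gaussianReal_apply hz _).map_eq]
    exact hz.map_eq
  exact this.indepFun h

theorem ae_tendsto_sum_mul_div (h_indep : iIndepFun s P)
    (h_ident : ∀ i, IdentDistrib (s i) (s 0) P P)
    (h_memLp : ∀ a, MemLp (fun ω => s 0 ω a) 2 P) (a a' : Fin q) :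
    ∀ᵐ ω ∂P, Tendsto (fun n : ℕ => (∑ i ∈ Finset.range n, s i ω a * s i ω a') / n) atTop
      (𝓝 (secondMoment P (s 0) a a')) := by
  have hmeas : Measurable fun v : Fin q → ℝ => v a * v a' := by fun_prop
  exact strong_law_ae_real (fun i ω => s i ω a * s i ω a')
    ((h_memLp a).integrable_mul (h_memLp a'))
    (fun i j hij => (h_indep.indepFun hij).comp hmeas hmeas) (fun i => (h_ident i).comp hmeas)

theorem ae_exists_eventually_sum_sq_le (h_indep : iIndepFun s P)
    (h_ident : ∀ i, IdentDistrib (s i) (s 0) P P)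
    (h_memLp : ∀ a, MemLp (fun ω => s 0 ω a) 2 P) (a : Fin q) :
    ∀ᵐ ω ∂P, ∃ B : ℝ, ∀ᶠ n : ℕ in atTop, ∑ i ∈ Finset.range n, s i ω a ^ 2 ≤ B * n := by
  filter_upwards [ae_tendsto_sum_mul_div h_indep h_ident h_memLp a a] with ω hω
  refine ⟨secondMoment P (s 0) a a + 1, ?_⟩
  filter_upwards [hω.eventually_le_const (lt_add_one _), eventually_gt_atTop 0] with n hn hn0
  rw [div_le_iff₀ (by exact_mod_cast hn0)] at hn
  simpa [sq] using hn

theorem ae_exists_eventually_abs_sum_mul_le [IsProbabilityMeasure P]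
    (h_indep : iIndepFun (fun (i : ℕ) (ω : Ω) => (s i ω, z i ω)) P)
    (h_ident : ∀ i, IdentDistrib (s i) (s 0) P P)
    (h_memLp : ∀ a, MemLp (fun ω => s 0 ω a) 2 P)
    (h_noise : ∀ i, HasLaw (z i) (Measure.pi fun _ : Fin p => gaussianReal 0 1) P)
    (a : Fin q) (b : Fin p)
    (hab : ∀ i, IndepFun (fun ω => s i ω a) (fun ω => z i ω b) P) :
    ∀ᵐ ω ∂P, ∃ c, ∀ᶠ n : ℕ in atTop, |∑ i ∈ Finset.range n, s i ω a * z i ω b| ≤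
      c * Real.sqrt (n * Real.log (Real.log n)) := by
  have hs : ∀ i, AEMeasurable (fun ω => s i ω a) P := fun i =>
    (measurable_pi_apply a).comp_aemeasurable (h_ident i).aemeasurable_fst
  have hz := fun i => hasLaw_gaussianReal_apply (h_noise i) b
  exact ae_exists_eventually_abs_sum_le (V := fun i ω => s i ω a ^ 2)
    (fun i => (hs i).mul (hz i).aemeasurable) (fun i => (hs i).pow_const 2)
    (h_indep.comp (fun _ v => (v.1 a * v.2 b, v.1 a ^ 2)) (fun _ => by fun_prop)) one_pos
    (fun i t _ => lintegral_exp_mul_mul_sub_le (hs i) (hz i) (hab i) t)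
    (ae_exists_eventually_sum_sq_le (h_indep.comp (fun _ v => v.1) fun _ => measurable_fst)
      h_ident h_memLp a)

theorem ae_exists_eventually_abs_sum_sq_sub_one_le [IsProbabilityMeasure P]
    (h_indep : iIndepFun z P)
    (h_noise : ∀ i, HasLaw (z i) (Measure.pi fun _ : Fin p => gaussianReal 0 1) P) (b : Fin p) :
    ∀ᵐ ω ∂P, ∃ c, ∀ᶠ n : ℕ in atTop, |∑ i ∈ Finset.range n, (z i ω b ^ 2 - 1)| ≤
      c * Real.sqrt (n * Real.log (Real.log n)) := by
  have hz := fun i => hasLaw_gaussianReal_apply (h_noise i) b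
  exact ae_exists_eventually_abs_sum_le (V := fun _ _ => 4)
    (fun i => ((hz i).aemeasurable.pow_const 2).sub_const 1) (fun _ => aemeasurable_const)
    (h_indep.comp (fun _ v => (v b ^ 2 - 1, (4 : ℝ))) (fun _ => by fun_prop))
    (by norm_num : (0 : ℝ) < 1 / 4)
    (fun i t ht => by
      have := (hz i).lintegral_comp
        (f := fun x => ENNReal.ofReal (Real.exp (t * (x ^ 2 - 1) - t ^ 2 * 4))) (by fun_prop)
      rw [this]
      exact lintegral_exp_mul_sq_sub_gaussian_le ht)
    (ae_of_all _ fun ω => ⟨4, Eventually.of_forall fun n => by simp [mul_comm]⟩)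

theorem ae_exists_eventually_abs_sum_noise_mul_sub_le [IsProbabilityMeasure P]
    (h_indep : iIndepFun z P)
    (h_noise : ∀ i, HasLaw (z i) (Measure.pi fun _ : Fin p => gaussianReal 0 1) P)
    (b b' : Fin p) :
    ∀ᵐ ω ∂P, ∃ c, ∀ᶠ n : ℕ in atTop,
      |∑ i ∈ Finset.range n, (z i ω b * z i ω b' - if b = b' then 1 else 0)| ≤
        c * Real.sqrt (n * Real.log (Real.log n)) := by
  by_cases hb : b = b'
  · subst hb
    simpa [sq] using ae_exists_eventually_abs_sum_sq_sub_one_le h_indep h_noise b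
  · simp only [hb, if_false, sub_zero]
    -- The noise itself plays the role of the signal: its distinct coordinates are independent and
    -- square integrable.
    refine ae_exists_eventually_abs_sum_mul_le
      (h_indep.comp (fun _ v => (v, v)) fun _ => by fun_prop)
      (fun i => ⟨(h_noise i).aemeasurable, (h_noise 0).aemeasurable,
        (h_noise i).map_eq.trans (h_noise 0).map_eq.symm⟩) (fun a => ?_) h_noise b b'
      (fun i => indepFun_apply_of_hasLaw_pi_gaussianReal (h_noise i) hb)
    have hg := hasLaw_gaussianReal_apply (h_noise 0) a
    have := memLp_id_gaussianReal (μ := 0) (v := 1) 2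
    rw [← hg.map_eq, memLp_map_measure_iff aestronglyMeasurable_id hg.aemeasurable] at this
    exact this

end

/-! ### Strong consistency -/

theorem theorem2 {Ω : Type*} [MeasurableSpace Ω] (P : Measure Ω) [IsProbabilityMeasure P]
    (p q : ℕ) (M : Matrix (Fin p) (Fin q) ℝ) (hM : LinearIndependent ℝ M.col)
    (σ : ℝ) (hσ : 0 < σ)
    (s : ℕ → Ω → Fin q → ℝ) (z : ℕ → Ω → Fin p → ℝ)
    (h_indep : iIndepFun (fun (i : ℕ) (ω : Ω) => (s i ω, z i ω)) P)
    (h_signal_noise : ∀ i, IndepFun (s i) (z i) P)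
    (h_ident : ∀ i, IdentDistrib (s i) (s 0) P P)
    (h_memLp : ∀ a, MemLp (fun ω => s 0 ω a) 2 P)
    (h_mean : ∀ a, ∫ ω, s 0 ω a ∂P = 0)
    (h_cov : (secondMoment P (s 0)).PosDef)
    (h_noise : ∀ i, HasLaw (z i) (Measure.pi fun _ : Fin p => gaussianReal 0 1) P)
    (C : ℕ → ℝ)
    (hC_upper : Tendsto (fun n : ℕ => C n / (n : ℝ)) atTop (𝓝 0))
    (hC_lower : Tendsto (fun n : ℕ => C n / Real.log (Real.log (n : ℝ))) atTop atTop)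
    (K : Finset ℕ) (hK : ∀ k ∈ K, k ≤ p) (hqK : q ∈ K) (hpK : q + 1 = p → p ∉ K)
    (khat : ℕ → Ω → ℕ)
    (h_mem : ∀ n ω, khat n ω ∈ K)
    (h_min : ∀ n ω, ∀ k ∈ K,
      IC σ (C n) (fun i => observation M σ (s i ω) (z i ω)) n (khat n ω) ≤
        IC σ (C n) (fun i => observation M σ (s i ω) (z i ω)) n k) :
    ∀ᵐ ω ∂P, Tendsto (fun n => khat n ω) atTop (𝓝 q) := by
  have hss := ae_all_iff.2 fun a => ae_all_iff.2 fun a' => ae_tendsto_sum_mul_div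
    (h_indep.comp (fun _ v => v.1) fun _ => measurable_fst) h_ident h_memLp a a'
  have hsz := ae_all_iff.2 fun a => ae_all_iff.2 fun b => ae_exists_eventually_abs_sum_mul_le
    h_indep h_ident h_memLp h_noise a b fun i =>
      (h_signal_noise i).comp (measurable_pi_apply a) (measurable_pi_apply b)
  have hzz := ae_all_iff.2 fun b => ae_all_iff.2 fun b' =>
    ae_exists_eventually_abs_sum_noise_mul_sub_le
      (h_indep.comp (fun _ v => v.2) fun _ => measurable_snd) h_noise b b'
  filter_upwards [hss, hsz, hzz] with ω hss hsz hzz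
  obtain ⟨⟨κ, hκ, hbig⟩, D, hsmall⟩ := sampleEig_asymptotics (s := fun i => s i ω)
    (z := fun i => z i ω) hM hσ h_cov tendsto_sqrt_mul_log_log_div
    (fun n => Real.sqrt_nonneg _) hss hsz hzz
  refine tendsto_of_eventually_IC_lt (fun n => h_mem n ω) (fun n => h_min n ω q hqK)
    fun k hk hkq => ?_
  rcases lt_or_gt_of_ne hkq with h | h
  · exact eventually_IC_lt_of_lt hσ (hK q hqK) h hκ hbig hC_upper
  · exact eventually_IC_lt_of_gt hσ h (hK k hk) (fun hc => hpK hc.1 (hc.2 ▸ hk)) hsmall hC_lower
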